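/- Let $X$ be a measurable space with $\sigma$-algebra $\mathcal O(X)$, and let $\mathcal H_1,\mathcal H_2$ be separable complex Hilbert spaces, with inner products linear in the second variable. A spectral measure on $X$ with values in $\mathcal B(\mathcal H)$ is a map $\pi:\mathcal O(X)\to\mathcal B(\mathcal H)$ such that every $\pi(A)$ is an orthogonal projection, $\pi(X)=I_{\mathcal H}$, and $A\mapsto\langle h,\pi(A)k\rangle$ is a complex measure for all $h,k\in\mathcal H$. If $\mathcal K\subseteq\mathcal H$ is a closed subspace invariant under all $\pi(A)$, the spectral measure $A\mapsto\pi(A)|_{\mathcal K}$ is called a sub-spectral measure of $\pi$; it is non-zero if $\mathcal K\neq\{0\}$. Two spectral measures $\rho_i:\mathcal O(X)\to\mathcal B(\mathcal K_i)$, $i=1,2$, are unitarily equivalent if there is a unitary $U:\mathcal K_1\to\mathcal K_2$ with $U\rho_1(A)=\rho_2(A)U$ for all $A\in\mathcal O(X)$. Let $\pi_i:\mathcal O(X)\to\mathcal B(\mathcal H_i)$, $i=1,2$, be two spectral measures. Then the following are equivalent: 1. $\pi_1$ and $\pi_2$ are mutually singular, i.e. there exist disjoint sets $X_1,X_2\in\mathcal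 O(X)$ such that $\pi_i(A)=\pi_i(A\cap X_i)$ for all $A\in\mathcal O(X)$ and $i=1,2$. 2. $\pi_1$ and $\pi_2$ are disjoint, i.e. no non-zero sub-spectral measure of $\pi_1$ is unitarily equivalent to any sub-spectral measure of $\pi_2$. 3. If $T\in\mathcal B(\mathcal H_1,\mathcal H_2)$ satisfies $T\pi_1(A)=\pi_2(A)T$ for all $A\in\mathcal O(X)$, then $T=0$. -/

import Mathlib

open MeasureTheory

/-- A positive operator valued measure on `X` with values in the bounded operators on `H`: the
value at each measurable set is a positive operator, and for all `h, k` the set function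
`A ↦ ⟪h, μ(A) k⟫` is a complex measure. (As for vector measures, sets which are not measurable are
sent to zero; this is forced by `isComplexMeasure`.) -/
structure POVM (X : Type*) [MeasurableSpace X] (H : Type*) [NormedAddCommGroup H]
    [InnerProductSpace ℂ H] where
  toFun : Set X → H →L[ℂ] H
  isPositive : ∀ A, MeasurableSet A → (toFun A).IsPositive
  isComplexMeasure : ∀ h k : H, ∃ ν : ComplexMeasure X, ∀ A, ν A = inner ℂ h (toFun A k)

namespace POVM

instance {X : Type*} [MeasurableSpace X] {H : Type*} [NormedAddCommGroup H]
    [InnerProductSpace ℂ H] : CoeFun (POVM X H) (fun _ => Set X → H →L[ℂ] H) :=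
  ⟨POVM.toFun⟩

/-- A spectral measure is a normalized projection valued measure: every `μ(A)` is an orthogonal
projection and `μ(X)` is the identity. -/
structure IsSpectral {X : Type*} [MeasurableSpace X] {H : Type*} [NormedAddCommGroup H]
    [InnerProductSpace ℂ H] [CompleteSpace H] (μ : POVM X H) : Prop where
  isProjection : ∀ A, MeasurableSet A → IsStarProjection (μ A)
  normalized : μ Set.univ = ContinuousLinearMap.id ℂ H

/-- `μ` is concentrated on `E` if `μ(A) = μ(A ∩ E)` for all measurable `A`. -/
def ConcentratedOn {X : Type*} [MeasurableSpace X] {H : Type*} [NormedAddCommGroup H]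
    [InnerProductSpace ℂ H] (μ : POVM X H) (E : Set X) : Prop :=
  ∀ A, MeasurableSet A → μ A = μ (A ∩ E)

/-- Two POVMs are mutually singular if they are concentrated on disjoint measurable sets. -/
def MutuallySingular {X : Type*} [MeasurableSpace X]
    {H₁ : Type*} [NormedAddCommGroup H₁] [InnerProductSpace ℂ H₁]
    {H₂ : Type*} [NormedAddCommGroup H₂] [InnerProductSpace ℂ H₂]
    (μ₁ : POVM X H₁) (μ₂ : POVM X H₂) : Prop :=
  ∃ X₁ X₂ : Set X, MeasurableSet X₁ ∧ MeasurableSet X₂ ∧ Disjoint X₁ X₂ ∧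
    μ₁.ConcentratedOn X₁ ∧ μ₂.ConcentratedOn X₂

/-- The subspace `K` is invariant under all the operators `μ(A)`. -/
def Invariant {X : Type*} [MeasurableSpace X] {H : Type*} [NormedAddCommGroup H]
    [InnerProductSpace ℂ H] (μ : POVM X H) (K : Submodule ℂ H) : Prop :=
  ∀ A, MeasurableSet A → ∀ x ∈ K, μ A x ∈ K

theorem apply_eq_zero_of_not_measurableSet {X : Type*} [MeasurableSpace X] {H : Type*}
    [NormedAddCommGroup H] [InnerProductSpace ℂ H] (μ : POVM X H) {A : Set X}
    (hA : ¬ MeasurableSet A) : μ A = 0 := by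
  ext k
  obtain ⟨ν, hν⟩ := μ.isComplexMeasure (μ A k) k
  have h := hν A
  rw [ν.not_measurable hA] at h
  exact inner_self_eq_zero.mp h.symm

theorem Invariant.mapsTo {X : Type*} [MeasurableSpace X] {H : Type*} [NormedAddCommGroup H]
    [InnerProductSpace ℂ H] {μ : POVM X H} {K : Submodule ℂ H} (hK : μ.Invariant K) (A : Set X) :
    Set.MapsTo (μ A) K K := by
  intro x hx
  by_cases hA : MeasurableSet A
  · exact hK A hA x hx
  · rw [μ.apply_eq_zero_of_not_measurableSet hA]
    exact K.zero_mem

/-- The restriction `A ↦ μ(A)|_K` of a POVM to an invariant subspace `K`. -/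
def restrict {X : Type*} [MeasurableSpace X] {H : Type*} [NormedAddCommGroup H]
    [InnerProductSpace ℂ H] (μ : POVM X H) (K : Submodule ℂ H) (hK : μ.Invariant K) :
    POVM X K where
  toFun A := (μ A).restrict (hK.mapsTo A)
  isPositive A hA := by
    refine ⟨fun x y => ?_, fun x => ?_⟩
    · exact (μ.isPositive A hA).1 (x : H) (y : H)
    · exact (μ.isPositive A hA).2 (x : H)
  isComplexMeasure h k := μ.isComplexMeasure (h : H) (k : H)

/-- The restriction of a spectral measure to a closed invariant subspace is a spectral measure;
these restrictions are the sub-spectral measures of `π`. -/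
theorem IsSpectral.restrict {X : Type*} [MeasurableSpace X] {H : Type*} [NormedAddCommGroup H]
    [InnerProductSpace ℂ H] [CompleteSpace H] {π : POVM X H} (hπ : π.IsSpectral)
    (K : Submodule ℂ H) [CompleteSpace K] (hK : π.Invariant K) :
    (π.restrict K hK).IsSpectral where
  isProjection A hA := by
    refine ⟨?_, ((π.restrict K hK).isPositive A hA).isSelfAdjoint⟩
    ext x
    exact congrArg (fun S : H →L[ℂ] H => S (x : H)) (hπ.isProjection A hA).isIdempotentElem
  normalized := by
    ext x
    exact congrArg (fun S : H →L[ℂ] H => S (x : H)) hπ.normalized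

/-- Two POVMs on `X` are unitarily equivalent if a unitary operator intertwines them. -/
def UnitarilyEquivalent {X : Type*} [MeasurableSpace X]
    {H₁ : Type*} [NormedAddCommGroup H₁] [InnerProductSpace ℂ H₁]
    {H₂ : Type*} [NormedAddCommGroup H₂] [InnerProductSpace ℂ H₂]
    (μ₁ : POVM X H₁) (μ₂ : POVM X H₂) : Prop :=
  ∃ U : H₁ ≃ₗᵢ[ℂ] H₂, ∀ A, MeasurableSet A → ∀ x : H₁, U (μ₁ A x) = μ₂ A (U x)

/-- `π₁` and `π₂` are disjoint if no non-zero sub-spectral measure of `π₁` (restriction to a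
non-zero closed invariant subspace) is unitarily equivalent to a sub-spectral measure of `π₂`. -/
def DisjointFrom {X : Type*} [MeasurableSpace X]
    {H₁ : Type*} [NormedAddCommGroup H₁] [InnerProductSpace ℂ H₁]
    {H₂ : Type*} [NormedAddCommGroup H₂] [InnerProductSpace ℂ H₂]
    (π₁ : POVM X H₁) (π₂ : POVM X H₂) : Prop :=
  ∀ (K₁ : Submodule ℂ H₁) (K₂ : Submodule ℂ H₂) (hK₁ : π₁.Invariant K₁) (hK₂ : π₂.Invariant K₂),
    IsClosed (K₁ : Set H₁) → IsClosed (K₂ : Set H₂) → K₁ ≠ ⊥ →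
      ¬ UnitarilyEquivalent (π₁.restrict K₁ hK₁) (π₂.restrict K₂ hK₂)

end POVM

/-!
If `π₁` and `π₂` live on disjoint sets, an intertwiner `T` satisfies `T = T π₁(X₁) = π₂(X₁) T = 0`;
and a unitary `U` between invariant subspaces `K₁`, `K₂` extends by the orthogonal projection onto
`K₁` to an intertwiner `H₁ → K₁ → K₂ → H₂`.

The remaining implication, from disjoint to mutually singular, goes through the scalar measures
`μ_h(A) = ⟪h, π(A) h⟫`. The map `1_A ↦ π(A) h` extends to an isometry `V` from `L²(μ_h)` onto the
cyclic subspace of `h`, under which `π(A)` becomes multiplication by `1_A`; the scalar measure of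
`V √f` is `f μ_h`. Two consequences:
* if a non-zero scalar measure of `π₁` is also one of `π₂`, the two cyclic subspaces are
  unitarily equivalent, so `π₁` and `π₂` are not disjoint;
* if `μ_h` and `μ_k` are not mutually singular, such a common scalar measure exists: by Lebesgue
  decomposition some restriction `μ_h|_S ≠ 0`, the scalar measure of `π₁(S) h`, is of the form
  `f μ_k` with `f` integrable.

So for disjoint `π₁`, `π₂` all these scalar measures are mutually singular, and by separability the
sums of the `μ_h` and of the `μ_k` over countable dense sets are separated by a single set.
-/

open scoped ENNReal

section InnerProductSpace

variable {ι 𝕜 E F : Type*} [RCLike 𝕜] [SeminormedAddCommGroup E] [InnerProductSpace 𝕜 E]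
  [NormedAddCommGroup F] [InnerProductSpace 𝕜 F]

theorem norm_linearCombination_eq_of_inner_eq {v : ι → E} {w : ι → F}
    (hvw : ∀ i j, inner 𝕜 (v i) (v j) = inner 𝕜 (w i) (w j)) (x : ι →₀ 𝕜) :
    ‖Finsupp.linearCombination 𝕜 v x‖ = ‖Finsupp.linearCombination 𝕜 w x‖ := by
  simp only [@norm_eq_sqrt_re_inner 𝕜, Finsupp.linearCombination_apply, Finsupp.sum, sum_inner,
    inner_sum, inner_smul_left, inner_smul_right, hvw]

theorem exists_linearIsometry_of_inner_eq [CompleteSpace F] {v : ι → E} {w : ι → F}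
    (hv : Dense (Submodule.span 𝕜 (Set.range v) : Set E))
    (hvw : ∀ i j, inner 𝕜 (v i) (v j) = inner 𝕜 (w i) (w j)) :
    ∃ V : E →ₗᵢ[𝕜] F, ∀ i, V (v i) = w i := by
  set e := Finsupp.linearCombination 𝕜 v
  set f := Finsupp.linearCombination 𝕜 w
  have he : DenseRange e := by
    rwa [← Finsupp.range_linearCombination, LinearMap.coe_range] at hv
  have hef (x) : ‖e x‖ = ‖f x‖ := norm_linearCombination_eq_of_inner_eq hvw x
  have hfe (x) : f.extendOfNorm e (e x) = f x :=
    LinearMap.extendOfNorm_eq he ⟨1, fun x ↦ by rw [hef, one_mul]⟩ x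
  have hnorm (x : E) : ‖f.extendOfNorm e x‖ = ‖x‖ :=
    he.induction_on x (isClosed_eq (by fun_prop) (by fun_prop)) fun y ↦ by rw [hfe, hef]
  exact ⟨⟨(f.extendOfNorm e).toLinearMap, hnorm⟩, fun i ↦ by
    simpa [e, f] using hfe (Finsupp.single i 1)⟩

end InnerProductSpace

section Lp

variable {X 𝕜 E : Type*} [MeasurableSpace X] [NontriviallyNormedField 𝕜] [NormedAddCommGroup E]
  [NormedSpace 𝕜 E] {μ : Measure X} {p : ℝ≥0∞} [Fact (1 ≤ p)] {A B : Set X}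

theorem dense_span_range_indicatorConstLp_one (hp : p ≠ ∞) :
    Dense (Submodule.span 𝕜 (Set.range fun A : {A : Set X // MeasurableSet A ∧ μ A ≠ ∞} ↦
      indicatorConstLp p A.2.1 A.2.2 (1 : 𝕜)) : Set (Lp 𝕜 p μ)) := by
  set S := Submodule.span 𝕜 (Set.range fun A : {A : Set X // MeasurableSet A ∧ μ A ≠ ∞} ↦
    indicatorConstLp p A.2.1 A.2.2 (1 : 𝕜))
  refine Submodule.dense_iff_topologicalClosure_eq_top.mpr (eq_top_iff.mpr fun g _ ↦ ?_)
  refine Lp.induction hp (motive := fun g ↦ g ∈ S.topologicalClosure) ?_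
    (fun _ _ _ _ _ ↦ add_mem) S.isClosed_topologicalClosure g
  intro c A hA hμA
  have hc : indicatorConstLp p hA hμA.ne c = c • indicatorConstLp p hA hμA.ne (1 : 𝕜) := by
    rw [indicatorConstLp, indicatorConstLp, ← MemLp.toLp_const_smul, MemLp.toLp_eq_toLp_iff]
    exact .of_forall fun x ↦ by by_cases hx : x ∈ A <;> simp [hx]
  rw [Lp.simpleFunc.coe_indicatorConst, hc]
  exact S.le_topologicalClosure (S.smul_mem c (Submodule.subset_span ⟨⟨A, hA, hμA.ne⟩, rfl⟩))

variable (𝕜 E μ p) in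
/-- Multiplication by the indicator of a measurable set, as a bounded operator on `Lᵖ`. It is the
model for the values of a spectral measure, see `POVM.IsSpectral.exists_cyclicEmbedding`. -/
noncomputable def indicatorMulL (hA : MeasurableSet A) : Lp E p μ →L[𝕜] Lp E p μ :=
  (ContinuousLinearMap.lsmul 𝕜 𝕜).holderL μ ∞ p p
    (((memLp_top_const (1 : 𝕜)).indicator hA).toLp (A.indicator fun _ ↦ 1))

theorem coeFn_indicatorMulL (hA : MeasurableSet A) (g : Lp E p μ) :
    indicatorMulL 𝕜 E μ p hA g =ᵐ[μ] A.indicator g := by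
  filter_upwards [(ContinuousLinearMap.lsmul 𝕜 𝕜).coeFn_holder (r := p)
    (((memLp_top_const (μ := μ) (1 : 𝕜)).indicator hA).toLp (A.indicator fun _ ↦ 1)) g,
    ((memLp_top_const (μ := μ) (1 : 𝕜)).indicator hA).coeFn_toLp] with x hmul hone
  refine hmul.trans ?_
  by_cases hx : x ∈ A <;> simp [hone, hx]

theorem indicatorMulL_indicatorConstLp (hA : MeasurableSet A) (hB : MeasurableSet B)
    (hμB : μ B ≠ ∞) (c : E) :
    indicatorMulL 𝕜 E μ p hA (indicatorConstLp p hB hμB c) =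
      indicatorConstLp p (hA.inter hB) (measure_inter_ne_top_of_right_ne_top hμB) c := by
  ext1
  filter_upwards [coeFn_indicatorMulL (𝕜 := 𝕜) hA (indicatorConstLp p hB hμB c),
    indicatorConstLp_coeFn (p := p) (hs := hB) (hμs := hμB) (c := c),
    indicatorConstLp_coeFn (p := p) (hs := hA.inter hB)
      (hμs := measure_inter_ne_top_of_right_ne_top hμB) (c := c)] with x hmul hB hAB
  rw [hmul, hAB, ← Set.indicator_indicator]
  by_cases hx : x ∈ A <;> simp [hx, hB]

theorem enorm_indicatorMulL_sq (hA : MeasurableSet A) (g : Lp E 2 μ) :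
    ‖indicatorMulL 𝕜 E μ 2 hA g‖ₑ ^ 2 = ∫⁻ x in A, ‖g x‖ₑ ^ 2 ∂μ := by
  rw [Lp.enorm_def, eLpNorm_congr_ae (coeFn_indicatorMulL hA g),
    eLpNorm_indicator_eq_eLpNorm_restrict hA]
  simpa using eLpNorm_nnreal_pow_eq_lintegral (f := g) (μ := μ.restrict A) two_ne_zero

end Lp

theorem exists_measurableSet_restrict_eq_withDensity_rnDeriv {X : Type*} [MeasurableSpace X]
    (μ ν : Measure X) [μ.HaveLebesgueDecomposition ν] :
    ∃ S, MeasurableSet S ∧ μ.restrict S = ν.withDensity (μ.rnDeriv ν) := by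
  obtain ⟨S, hS, hμS, hνS⟩ := μ.mutuallySingular_singularPart ν
  refine ⟨S, hS, ?_⟩
  have hac : (ν.withDensity (μ.rnDeriv ν)).restrict S = ν.withDensity (μ.rnDeriv ν) :=
    Measure.restrict_eq_self_of_ae_mem (withDensity_absolutelyContinuous ν _ hνS)
  conv_lhs => rw [μ.haveLebesgueDecomposition_add ν]
  rw [Measure.restrict_add, Measure.restrict_eq_zero.mpr hμS, zero_add, hac]

namespace POVM

variable {X : Type*} [MeasurableSpace X]
  {H : Type*} [NormedAddCommGroup H] [InnerProductSpace ℂ H] {π : POVM X H}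
  {H' : Type*} [NormedAddCommGroup H'] [InnerProductSpace ℂ H'] {π' : POVM X H'}
  {A B : Set X}

section Additivity

theorem apply_empty (π : POVM X H) : π ∅ = 0 := by
  ext k
  obtain ⟨ν, hν⟩ := π.isComplexMeasure (π ∅ k) k
  exact inner_self_eq_zero.mp ((hν ∅).symm.trans ν.empty)

theorem apply_union (π : POVM X H) (hA : MeasurableSet A) (hB : MeasurableSet B)
    (hAB : Disjoint A B) : π (A ∪ B) = π A + π B := by
  ext k
  refine ext_inner_left ℂ fun h ↦ ?_
  obtain ⟨ν, hν⟩ := π.isComplexMeasure h k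
  rw [add_apply, inner_add_right, ← hν, ← hν, ← hν, VectorMeasure.of_union hAB hA hB]

theorem apply_inter_add_diff (π : POVM X H) (hA : MeasurableSet A) (hB : MeasurableSet B) :
    π (A ∩ B) + π (A \ B) = π A := by
  rw [← π.apply_union (hA.inter hB) (hA.diff hB) Set.disjoint_sdiff_inter.symm,
    Set.inter_union_sdiff]

theorem inner_apply_left (π : POVM X H) (hA : MeasurableSet A) (x y : H) :
    inner ℂ (π A x) y = inner ℂ x (π A y) :=
  (π.isPositive A hA).isSymmetric x y

end Additivity

section Intertwiners

theorem eq_zero_of_mutuallySingular_of_intertwines (hπ : π Set.univ = ContinuousLinearMap.id ℂ H)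
    (hs : π.MutuallySingular π') (T : H →L[ℂ] H')
    (hT : ∀ A, MeasurableSet A → T ∘L π A = π' A ∘L T) : T = 0 := by
  obtain ⟨S, S', hS, -, hd, hc, hc'⟩ := hs
  have hπS : π S = ContinuousLinearMap.id ℂ H := by
    rw [← hπ, hc _ MeasurableSet.univ, Set.univ_inter]
  have hπ'S : π' S = 0 := by rw [hc' S hS, hd.inter_eq, π'.apply_empty]
  simpa only [hπS, hπ'S, ContinuousLinearMap.comp_id, ContinuousLinearMap.zero_comp] using hT S hS

theorem Invariant.orthogonalProjectionOnto_apply {K : Submodule ℂ H} [K.HasOrthogonalProjection]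
    (hK : π.Invariant K) (hA : MeasurableSet A) (x : H) :
    K.orthogonalProjectionOnto (π A x) = π.restrict K hK A (K.orthogonalProjectionOnto x) := by
  refine Subtype.ext (Submodule.eq_starProjection_of_mem_of_inner_eq_zero
    (v := π A (K.orthogonalProjectionOnto x)) (hK A hA _ (Subtype.coe_prop _)) fun w hw ↦ ?_)
  rw [← map_sub, π.inner_apply_left hA]
  exact Submodule.starProjection_inner_eq_zero x _ (hK A hA w hw)

theorem disjointFrom_of_forall_intertwiner_eq_zero [CompleteSpace H]
    (h : ∀ T : H →L[ℂ] H', (∀ A, MeasurableSet A → T ∘L π A = π' A ∘L T) → T = 0) :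
    π.DisjointFrom π' := by
  rintro K K' hK hK' hKc - hK0 ⟨U, hU⟩
  have : CompleteSpace K := hKc.completeSpace_coe
  let T : H →L[ℂ] H' :=
    K'.subtypeL ∘L (U.toContinuousLinearEquiv : K →L[ℂ] K') ∘L K.orthogonalProjectionOnto
  have hT (x : H) : T x = U (K.orthogonalProjectionOnto x) := rfl
  have hT0 : T = 0 := h T fun A hA ↦ ContinuousLinearMap.ext fun x ↦ by
    rw [ContinuousLinearMap.comp_apply, hT, hK.orthogonalProjectionOnto_apply hA, hU A hA]
    rfl
  refine hK0 (K.eq_bot_iff.mpr fun x hx ↦ ?_)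
  have hUx : U ⟨x, hx⟩ = 0 := by
    rw [← K.orthogonalProjectionOnto_mem_subspace_eq_self ⟨x, hx⟩, ← ZeroMemClass.coe_eq_zero,
      ← hT, hT0, zero_apply]
  exact congrArg Subtype.val (U.map_eq_zero_iff.mp hUx)

theorem not_disjointFrom_of_linearIsometry {E : Type*} [NormedAddCommGroup E]
    [InnerProductSpace ℂ E] [CompleteSpace E] [Nontrivial E]
    {M : ∀ A : Set X, MeasurableSet A → E → E} (V : E →ₗᵢ[ℂ] H) (V' : E →ₗᵢ[ℂ] H')
    (hV : ∀ A hA x, π A (V x) = V (M A hA x)) (hV' : ∀ A hA x, π' A (V' x) = V' (M A hA x)) :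
    ¬ π.DisjointFrom π' := by
  have hinv : π.Invariant (LinearMap.range V.toLinearMap) := by
    rintro A hA _ ⟨x, rfl⟩
    exact ⟨M A hA x, (hV A hA x).symm⟩
  have hinv' : π'.Invariant (LinearMap.range V'.toLinearMap) := by
    rintro A hA _ ⟨x, rfl⟩
    exact ⟨M A hA x, (hV' A hA x).symm⟩
  have hne : LinearMap.range V.toLinearMap ≠ ⊥ := by
    obtain ⟨x, hx⟩ := exists_ne (0 : E)
    have hVx : V x ≠ 0 := (map_ne_zero_iff V V.injective).mpr hx
    exact (Submodule.ne_bot_iff _).mpr ⟨V x, ⟨x, rfl⟩, hVx⟩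
  refine fun hdis ↦ hdis _ _ hinv hinv' V.isometry.isClosedEmbedding.isClosed_range
    V'.isometry.isClosedEmbedding.isClosed_range hne
    ⟨V.equivRange.symm.trans V'.equivRange, fun A hA y ↦ ?_⟩
  obtain ⟨x, rfl⟩ := V.equivRange.surjective y
  have hx : π.restrict _ hinv A (V.equivRange x) = V.equivRange (M A hA x) :=
    Subtype.ext (hV A hA x)
  rw [hx, LinearIsometryEquiv.trans_apply, LinearIsometryEquiv.trans_apply,
    LinearIsometryEquiv.symm_apply_apply, LinearIsometryEquiv.symm_apply_apply]
  exact Subtype.ext (hV' A hA x).symm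

end Intertwiners

section ScalarMeasure

/-- The scalar measure `A ↦ ⟪h, π(A) h⟫` of a vector `h`. It is extracted from the complex measure
provided by `isComplexMeasure`, whose values are real and nonnegative. -/
noncomputable def scalarMeasure (π : POVM X H) (h : H) : Measure X :=
  (ComplexMeasure.re (π.isComplexMeasure h h).choose).toMeasureOfZeroLE Set.univ MeasurableSet.univ
    (VectorMeasure.restrict_le_restrict_of_subset_le _ _ fun A hA _ ↦
      ((π.isPositive A hA).re_inner_nonneg_right h).trans_eq
        (congrArg Complex.re ((π.isComplexMeasure h h).choose_spec A)).symm)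

instance (π : POVM X H) (h : H) : IsFiniteMeasure (π.scalarMeasure h) :=
  inferInstanceAs (IsFiniteMeasure (SignedMeasure.toMeasureOfZeroLE ..))

theorem ofReal_scalarMeasure_real (π : POVM X H) (h : H) (hA : MeasurableSet A) :
    ((π.scalarMeasure h).real A : ℂ) = inner ℂ h (π A h) := by
  rw [scalarMeasure, SignedMeasure.toMeasureOfZeroLE_real_apply _ _ MeasurableSet.univ hA,
    Set.univ_inter]
  refine .trans ?_ ((π.isPositive A hA).isSymmetric.coe_re_inner_self_apply h)
  exact congr(($((π.isComplexMeasure h h).choose_spec A).re : ℂ))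

end ScalarMeasure

namespace IsSpectral

variable [CompleteSpace H]

section Multiplicativity

theorem mul_eq_left_of_subset (hπ : π.IsSpectral) (hA : MeasurableSet A) (hB : MeasurableSet B)
    (hAB : A ⊆ B) : π A * π B = π A := by
  have : IsAddTorsionFree (H →L[ℂ] H) := .of_isTorsionFree ℂ _
  rw [← (hπ.isProjection A hA).sub_iff_mul_eq_left (hπ.isProjection B hB),
    ← π.apply_inter_add_diff hB hA, Set.inter_eq_self_of_subset_right hAB, add_sub_cancel_left]
  exact hπ.isProjection _ (hB.diff hA)

theorem apply_compl (hπ : π.IsSpectral) (hA : MeasurableSet A) : π Aᶜ = 1 - π A := by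
  rw [eq_sub_iff_add_eq', ← π.apply_union hA hA.compl disjoint_compl_right, Set.union_compl_self]
  exact hπ.normalized

theorem mul_eq_apply_inter (hπ : π.IsSpectral) (hA : MeasurableSet A) (hB : MeasurableSet B) :
    π A * π B = π (A ∩ B) := by
  have hdiff : π (A \ B) * π B = 0 := by
    have h := hπ.mul_eq_left_of_subset (hA.diff hB) hB.compl (Set.sdiff_subset_compl A B)
    rwa [hπ.apply_compl hB, mul_sub, mul_one, sub_eq_self] at h
  rw [← π.apply_inter_add_diff hA hB, add_mul, hdiff, add_zero,
    hπ.mul_eq_left_of_subset (hA.inter hB) hB Set.inter_subset_right]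

theorem apply_apply (hπ : π.IsSpectral) (hA : MeasurableSet A) (hB : MeasurableSet B) (x : H) :
    π A (π B x) = π (A ∩ B) x :=
  congr($(hπ.mul_eq_apply_inter hA hB) x)

theorem inner_apply_apply (hπ : π.IsSpectral) (hA : MeasurableSet A) (hB : MeasurableSet B)
    (x y : H) : inner ℂ (π A x) (π B y) = inner ℂ x (π (A ∩ B) y) := by
  rw [π.inner_apply_left hA, hπ.apply_apply hA hB]

theorem concentratedOn_of_apply_compl_eq_zero (hπ : π.IsSpectral) {S : Set X}
    (hS : MeasurableSet S) (h : π Sᶜ = 0) : π.ConcentratedOn S := by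
  intro A hA
  rw [← π.apply_inter_add_diff hA hS, Set.sdiff_eq, ← hπ.mul_eq_apply_inter hA hS.compl, h,
    mul_zero, add_zero]

end Multiplicativity

section ScalarMeasure

theorem scalarMeasure_apply (hπ : π.IsSpectral) (h : H) (hA : MeasurableSet A) :
    π.scalarMeasure h A = ‖π A h‖ₑ ^ 2 := by
  have hreal : (π.scalarMeasure h).real A = ‖π A h‖ ^ 2 := by
    rw [← Complex.ofReal_inj, π.ofReal_scalarMeasure_real h hA, ← Set.inter_self A,
      ← hπ.inner_apply_apply hA hA, Set.inter_self, inner_self_eq_norm_sq_to_K]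
    norm_cast
  rw [← ofReal_measureReal, hreal, ENNReal.ofReal_pow (norm_nonneg _), ofReal_norm]

theorem scalarMeasure_eq_zero_iff (hπ : π.IsSpectral) (h : H) (hA : MeasurableSet A) :
    π.scalarMeasure h A = 0 ↔ π A h = 0 := by
  rw [hπ.scalarMeasure_apply h hA, pow_eq_zero_iff two_ne_zero, enorm_eq_zero]

theorem restrict_scalarMeasure (hπ : π.IsSpectral) (h : H) {S : Set X} (hS : MeasurableSet S) :
    (π.scalarMeasure h).restrict S = π.scalarMeasure (π S h) := by
  ext A hA
  rw [Measure.restrict_apply hA, hπ.scalarMeasure_apply _ hA,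
    hπ.scalarMeasure_apply h (hA.inter hS), hπ.apply_apply hA hS]

theorem apply_eq_zero_of_denseRange (hπ : π.IsSpectral) {ι : Type*} {u : ι → H}
    (hu : DenseRange u) (hA : MeasurableSet A) (h0 : ∀ i, π.scalarMeasure (u i) A = 0) :
    π A = 0 :=
  ContinuousLinearMap.ext fun x ↦
    hu.induction_on x (isClosed_eq (by fun_prop) continuous_const) fun i ↦
      (hπ.scalarMeasure_eq_zero_iff (u i) hA).mp (h0 i)

theorem exists_cyclicEmbedding (hπ : π.IsSpectral) (h : H) :
    ∃ V : Lp ℂ 2 (π.scalarMeasure h) →ₗᵢ[ℂ] H, h ∈ Set.range V ∧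
      ∀ A (hA : MeasurableSet A) g, π A (V g) = V (indicatorMulL ℂ ℂ _ 2 hA g) := by
  have hdense := dense_span_range_indicatorConstLp_one (𝕜 := ℂ) (μ := π.scalarMeasure h)
    (p := 2) ENNReal.ofNat_ne_top
  obtain ⟨V, hV⟩ := exists_linearIsometry_of_inner_eq (w := fun A ↦ π A.1 h) hdense fun A B ↦ by
    rw [L2.inner_indicatorConstLp_one_indicatorConstLp_one, hπ.inner_apply_apply A.2.1 B.2.1,
      ← π.ofReal_scalarMeasure_real h (A.2.1.inter B.2.1)]
    rfl
  have hV (A : Set X) (hA : MeasurableSet A) :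
      V (indicatorConstLp 2 hA (measure_ne_top _ A) 1) = π A h := hV ⟨A, hA, measure_ne_top _ A⟩
  refine ⟨V, ⟨_, (hV Set.univ MeasurableSet.univ).trans congr($hπ.normalized h)⟩, fun A hA g ↦ ?_⟩
  have hint : π A ∘L V.toContinuousLinearMap =
      V.toContinuousLinearMap ∘L indicatorMulL ℂ ℂ _ 2 hA := by
    refine ContinuousLinearMap.ext_on hdense ?_
    rintro _ ⟨⟨B, hB, -⟩, rfl⟩
    simp only [ContinuousLinearMap.comp_apply, LinearIsometry.coe_toContinuousLinearMap,
      indicatorMulL_indicatorConstLp, hV, hπ.apply_apply hA hB]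
  exact congr($hint g)

theorem scalarMeasure_linearIsometry_apply (hπ : π.IsSpectral) {ν : Measure X}
    {V : Lp ℂ 2 ν →ₗᵢ[ℂ] H}
    (hV : ∀ A (hA : MeasurableSet A) g, π A (V g) = V (indicatorMulL ℂ ℂ ν 2 hA g))
    (g : Lp ℂ 2 ν) : π.scalarMeasure (V g) = ν.withDensity fun x ↦ ‖g x‖ₑ ^ 2 := by
  ext A hA
  rw [hπ.scalarMeasure_apply _ hA, hV A hA, V.enorm_map, enorm_indicatorMulL_sq,
    withDensity_apply _ hA]

theorem exists_scalarMeasure_eq_withDensity (hπ : π.IsSpectral) (h : H) {f : X → ℝ≥0∞}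
    (hf : Measurable f) (hfi : ∫⁻ x, f x ∂π.scalarMeasure h ≠ ∞) :
    ∃ k, π.scalarMeasure k = (π.scalarMeasure h).withDensity f := by
  obtain ⟨V, -, hV⟩ := hπ.exists_cyclicEmbedding h
  let r (x : X) : ℂ := √(f x).toReal
  have hr_norm (x : X) : ‖r x‖ ^ 2 = (f x).toReal := by
    rw [Complex.norm_real, Real.norm_of_nonneg (Real.sqrt_nonneg _),
      Real.sq_sqrt ENNReal.toReal_nonneg]
  have hr : MemLp r 2 (π.scalarMeasure h) := by
    rw [memLp_two_iff_integrable_sq_norm (by fun_prop)]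
    simpa only [hr_norm] using integrable_toReal_of_lintegral_ne_top hf.aemeasurable hfi
  refine ⟨V (hr.toLp r), ?_⟩
  rw [hπ.scalarMeasure_linearIsometry_apply hV]
  refine withDensity_congr_ae ?_
  filter_upwards [hr.coeFn_toLp, ae_lt_top hf hfi] with x hx hfx
  rw [hx, ← ofReal_norm, ← ENNReal.ofReal_pow (norm_nonneg _), hr_norm,
    ENNReal.ofReal_toReal hfx.ne]

variable [CompleteSpace H']

theorem not_disjointFrom_of_scalarMeasure_eq (hπ : π.IsSpectral) (hπ' : π'.IsSpectral) {h : H}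
    {h' : H'} (hh : h ≠ 0) (heq : π.scalarMeasure h = π'.scalarMeasure h') :
    ¬ π.DisjointFrom π' := by
  obtain ⟨V, ⟨g, hg⟩, hV⟩ := hπ.exists_cyclicEmbedding h
  have hV' := hπ'.exists_cyclicEmbedding h'
  rw [← heq] at hV'
  obtain ⟨V', -, hV'⟩ := hV'
  have : Nontrivial (Lp ℂ 2 (π.scalarMeasure h)) :=
    nontrivial_of_ne g 0 fun hg0 ↦ hh (by rw [← hg, hg0, map_zero])
  exact not_disjointFrom_of_linearIsometry V V' hV hV'

theorem mutuallySingular_scalarMeasure_of_disjointFrom (hπ : π.IsSpectral)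
    (hπ' : π'.IsSpectral) (hdis : π.DisjointFrom π') (h : H) (h' : H') :
    π.scalarMeasure h ⟂ₘ π'.scalarMeasure h' := by
  obtain ⟨S, hS, hdensity⟩ := exists_measurableSet_restrict_eq_withDensity_rnDeriv
    (π.scalarMeasure h) (π'.scalarMeasure h')
  obtain ⟨k, hk⟩ := hπ'.exists_scalarMeasure_eq_withDensity h' (Measure.measurable_rnDeriv _ _)
    (Measure.lintegral_rnDeriv_lt_top (π.scalarMeasure h) _).ne
  rw [hπ.restrict_scalarMeasure h hS] at hdensity
  have hSh : π S h = 0 := of_not_not fun hne ↦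
    hπ.not_disjointFrom_of_scalarMeasure_eq hπ' hne (hdensity.trans hk.symm) hdis
  rw [← Measure.withDensity_rnDeriv_eq_zero, ← hdensity, hSh, ← Measure.measure_univ_eq_zero,
    hπ.scalarMeasure_eq_zero_iff _ MeasurableSet.univ, map_zero]

theorem mutuallySingular_of_disjointFrom [TopologicalSpace.SeparableSpace H]
    [TopologicalSpace.SeparableSpace H'] (hπ : π.IsSpectral) (hπ' : π'.IsSpectral)
    (hdis : π.DisjointFrom π') : π.MutuallySingular π' := by
  let u := TopologicalSpace.denseSeq H
  let u' := TopologicalSpace.denseSeq H'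
  have hsing : Measure.sum (fun n ↦ π.scalarMeasure (u n)) ⟂ₘ
      Measure.sum fun n ↦ π'.scalarMeasure (u' n) := by
    simp only [Measure.MutuallySingular.sum_left, Measure.MutuallySingular.sum_right]
    exact fun n m ↦ hπ.mutuallySingular_scalarMeasure_of_disjointFrom hπ' hdis (u m) (u' n)
  obtain ⟨S, hS, hnull, hnull'⟩ := hsing
  rw [Measure.sum_apply_eq_zero' hS] at hnull
  rw [Measure.sum_apply_eq_zero' hS.compl] at hnull'
  have hπS : π S = 0 :=
    hπ.apply_eq_zero_of_denseRange (TopologicalSpace.denseRange_denseSeq H) hS hnull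
  have hπ'S : π' Sᶜ = 0 :=
    hπ'.apply_eq_zero_of_denseRange (TopologicalSpace.denseRange_denseSeq H') hS.compl hnull'
  exact ⟨Sᶜ, S, hS.compl, hS, disjoint_compl_left,
    hπ.concentratedOn_of_apply_compl_eq_zero hS.compl (by rwa [compl_compl]),
    hπ'.concentratedOn_of_apply_compl_eq_zero hS hπ'S⟩

end ScalarMeasure

end IsSpectral

end POVM

theorem mainTheorem8 {X : Type*} [MeasurableSpace X]
    {H₁ : Type*} [NormedAddCommGroup H₁] [InnerProductSpace ℂ H₁] [CompleteSpace H₁]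
    [TopologicalSpace.SeparableSpace H₁]
    {H₂ : Type*} [NormedAddCommGroup H₂] [InnerProductSpace ℂ H₂] [CompleteSpace H₂]
    [TopologicalSpace.SeparableSpace H₂]
    (π₁ : POVM X H₁) (π₂ : POVM X H₂) (hπ₁ : π₁.IsSpectral) (hπ₂ : π₂.IsSpectral) :
    List.TFAE [
      POVM.MutuallySingular π₁ π₂,
      POVM.DisjointFrom π₁ π₂,
      ∀ T : H₁ →L[ℂ] H₂,
        (∀ A, MeasurableSet A → T ∘L π₁ A = π₂ A ∘L T) → T = 0] := by
  tfae_have 1 → 3 := POVM.eq_zero_of_mutuallySingular_of_intertwines hπ₁.normalized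
  tfae_have 3 → 2 := POVM.disjointFrom_of_forall_intertwiner_eq_zero
  tfae_have 2 → 1 := hπ₁.mutuallySingular_of_disjointFrom hπ₂
  tfae_finish
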